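/- Notation. Every rational number $\alpha>1$ has a unique regular continued fraction expansion of even length $$\alpha=[a_1,\dots,a_{2m}]=a_1+\cfrac{1}{a_2+\cfrac{1}{\ddots+\cfrac1{a_{2m}}}},\qquad a_1,\dots,a_{2m}\in\mathbb Z_{\ge 1},\ m\ge 1 .$$ Put $R=\begin{pmatrix}1&1\\0&1\end{pmatrix}$, $L=\begin{pmatrix}1&0\\1&1\end{pmatrix}$ and $M(a_1,\dots,a_{2m})=R^{a_1}L^{a_2}\cdots R^{a_{2m-1}}L^{a_{2m}}$. Let $L(\alpha)$ be the rational link of $\alpha$: on three horizontal strands numbered $0,1,2$ from top to bottom, draw from left to right $a_1$ half twists of the strands $1,2$, then $a_2$ half twists of the strands $0,1$, then $a_3$ half twists of the strands $1,2$, and so on up to $a_{2m}$; in the twists of the strands $1,2$ the strand from lower left to upper right is the over strand, in the twists of the strands $0,1$ the strand from upper left to lower right is. Close up by joining the left ends of the strands $0$ and $1$, the right ends of the strands $1$ and $2$, and the right end of strand $0$ with the left end of strand $2$ by an arc around the diagram. Let $V_{L(\alpha)}(t)$ be the Jones polynomial of $L(\alpha)$ (for any orientation), let $\pm t^h$ be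 its leading term (the term of highest degree in $t$), and let $$J_\alpha(q)=\pm t^{-h}V_{L(\alpha)}(t)\big|_{t=-q^{-1}}\in\mathbb Z[q],\qquad J_\alpha(0)=1,$$ be the normalized Jones polynomial (it does not depend on the orientation). For $f\in\mathbb Z[q]$ write $f^\vee(q)=q^{\deg f}f(q^{-1})$. If $J_\alpha^\vee\ne J_\alpha$, let $I_\alpha(q)\in\mathbb Z[q]$ be the unique polynomial with $I_\alpha(0)>0$ of the form $$I_\alpha(q)=\pm q^{N}\,\frac{J_\alpha(q)^\vee-J_\alpha(q)}{1-q},\qquad N\in\mathbb Z;$$ if $J_\alpha^\vee=J_\alpha$, put $I_\alpha=0$. Proposition. Let $r>s>0$ be coprime integers and $\alpha=\frac rs=[a_1,\dots,a_{2m}]$. Then $M(a_1,\dots,a_{2m})=\begin{pmatrix}r&t\\s&u\end{pmatrix}$ for some integers $t,u$, and for every integer $i\ge 0$ the fraction $$\alpha_i=\frac{r+i(s+t)+i^2u}{s+iu}$$ is irreducible with positive denominator, satisfies $\alpha_i>1$, and $$I_{\alpha_i}(q)=I_\alpha(q).$$ The $\alpha_i$ ($i\ge 0$) are pairwise distinct;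 in particular, there are infinitely many irreducible fractions $\beta>1$ with $I_\beta(q)=I_\alpha(q)$. -/

import Mathlib

open Polynomial LaurentPolynomial

namespace QRat

/-! ### Continued fractions and the matrices `M(a₁, …, a₂ₘ)` -/

/-- The quotients of the Euclidean algorithm for `r / s`, that is, the regular continued fraction
expansion of `r / s`. -/
def euclid : ℕ → ℕ → List ℕ
  | _, 0 => []
  | r, s + 1 => r / (s + 1) :: euclid (s + 1) (r % (s + 1))
termination_by _ s => s
decreasing_by exact Nat.mod_lt _ (Nat.succ_pos s)

/-- The regular continued fraction expansion `[a₁, …, a₂ₘ]` of even length of a rational number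
`α > 1`: if the Euclidean expansion `[a₁, …, aₙ]` has odd length, it is replaced by
`[a₁, …, aₙ - 1, 1]`. -/
def evenCF (α : ℚ) : List ℕ :=
  let l := euclid α.num.toNat α.den
  if Even l.length then l else l.dropLast ++ [l.getLastD 0 - 1, 1]

/-- `M(a₁, …, a₂ₘ) = R ^ a₁ * L ^ a₂ * ⋯ * R ^ a₂ₘ₋₁ * L ^ a₂ₘ` with `R = (1 1; 0 1)` and
`L = (1 0; 1 1)`. -/
def cfMatrix : List ℕ → Matrix (Fin 2) (Fin 2) ℤ
  | [] => 1
  | [a] => !![1, 1; 0, 1] ^ a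
  | a :: b :: l => !![1, 1; 0, 1] ^ a * !![1, 0; 1, 1] ^ b * cfMatrix l

/-! ### Diagrams of rational links -/

/-- A crossing of two neighbouring strands among three horizontal strands, numbered `0, 1, 2` from
top to bottom. The strands number `pos` and `pos + 1` cross; `desc = true` means that the strand
from the upper left to the lower right is the upper (over) strand, `desc = false` that the strand
from the lower left to the upper right is. -/
structure Crossing where
  pos : Fin 2
  desc : Bool

/-- The number of the upper one of the two strand positions at a crossing. -/
def Crossing.top (c : Crossing) : Fin 3 := c.pos.castSucc

/-- The number of the lower one of the two strand positions at a crossing. -/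
def Crossing.bot (c : Crossing) : Fin 3 := c.pos.succ

/-- A word `w` of crossings, read from left to right, is regarded as a link diagram as follows. For
`k = 0, …, N` with `N = w.length`, the `k`-th vertical line lies to the left of the crossing number
`k` and to the right of the crossing number `k - 1`; it meets the three strands in the points
`(k, 0), (k, 1), (k, 2)`. Outside of the crossings, the diagram is closed by three arcs: one joins
`(0, 0)` with `(0, 1)` on the left, one joins `(N, 1)` with `(N, 2)` on the right, and one runs
around the diagram and joins `(N, 0)` with `(0, 2)`. -/
abbrev Point (w : List Crossing) : Type := Fin (w.length + 1) × Fin 3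

/-- `Joined w σ x y`: the points `x` and `y` are the two ends of one of the arcs of the diagram that
is obtained from the diagram of `w` by smoothing every crossing as prescribed by the state `σ`
(`true` for the `A`-smoothing, `false` for the `B`-smoothing). The `A`-smoothing joins the two
regions that are swept out when the over strand is turned counterclockwise; so it produces two
horizontal arcs if `desc = true`, and two vertical (cup and cap) arcs if `desc = false`. -/
inductive Joined (w : List Crossing) (σ : Fin w.length → Bool) : Point w → Point w → Prop
  | left : Joined w σ (0, 0) (0, 1)
  | right : Joined w σ (Fin.last _, 1) (Fin.last _, 2)
  | back : Joined w σ (Fin.last _, 0) (0, 2)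
  | idle (k : Fin w.length) (j : Fin 3) (ht : j ≠ (w.get k).top) (hb : j ≠ (w.get k).bot) :
      Joined w σ (k.castSucc, j) (k.succ, j)
  | horizontal_top (k : Fin w.length) (h : σ k = (w.get k).desc) :
      Joined w σ (k.castSucc, (w.get k).top) (k.succ, (w.get k).top)
  | horizontal_bot (k : Fin w.length) (h : σ k = (w.get k).desc) :
      Joined w σ (k.castSucc, (w.get k).bot) (k.succ, (w.get k).bot)
  | vertical_left (k : Fin w.length) (h : σ k ≠ (w.get k).desc) :
      Joined w σ (k.castSucc, (w.get k).top) (k.castSucc, (w.get k).bot)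
  | vertical_right (k : Fin w.length) (h : σ k ≠ (w.get k).desc) :
      Joined w σ (k.succ, (w.get k).top) (k.succ, (w.get k).bot)

/-- The number of closed loops of the smoothed diagram. -/
noncomputable def loops (w : List Crossing) (σ : Fin w.length → Bool) : ℕ :=
  Nat.card (Quot (Joined w σ))

/-- The Kauffman bracket (normalized to be `1` on the unknot diagram without crossings), by the
state sum; the variable `A` is `T 1`. -/
noncomputable def bracket (w : List Crossing) : ℤ[T;T⁻¹] :=
  ∑ σ : Fin w.length → Bool,
    T (∑ k, if σ k then (1 : ℤ) else -1) * (-T 2 - T (-2)) ^ (loops w σ - 1)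

/-- An orientation of the link diagram of `w`: a direction at every point, `1` for "from left to
right" and `-1` for "from right to left", that is compatible along the strands (which change places
at a crossing) and along the three closing arcs. -/
structure Orientation (w : List Crossing) where
  dir : Fin (w.length + 1) → Fin 3 → ℤˣ
  strand : ∀ (k : Fin w.length) (j : Fin 3),
    dir k.succ j = dir k.castSucc (Equiv.swap (w.get k).top (w.get k).bot j)
  left : dir 0 0 = -dir 0 1
  right : dir (Fin.last _) 1 = -dir (Fin.last _) 2
  back : dir (Fin.last _) 0 = dir 0 2

/-- The writhe, the sum of the signs of the crossings. A crossing with `desc = true` is positive if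
both of its strands run in the same horizontal direction, and negative otherwise; for
`desc = false` it is the other way around. -/
def writhe (w : List Crossing) (o : Orientation w) : ℤ :=
  ∑ k : Fin w.length, (if (w.get k).desc then 1 else -1) *
    ((o.dir k.castSucc (w.get k).top * o.dir k.castSucc (w.get k).bot : ℤˣ) : ℤ)

/-- The Jones polynomial `V(t)` of an oriented diagram, written in the variable `A` with
`t = A ^ (-4)`: it is `(-A ^ 3) ^ (-writhe)` times the Kauffman bracket. -/
noncomputable def jones (w : List Crossing) (o : Orientation w) : ℤ[T;T⁻¹] :=
  LaurentPolynomial.C (((-1 : ℤˣ) ^ writhe w o : ℤˣ) : ℤ) * T (-3 * writhe w o) * bracket w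

/-- Every diagram can be oriented. -/
theorem nonempty_orientation (w : List Crossing) : Nonempty (Orientation w) := by
  let step : ℕ → Equiv.Perm (Fin 3) := fun k =>
    if h : k < w.length then Equiv.swap (w.get ⟨k, h⟩).top (w.get ⟨k, h⟩).bot else 1
  let p : ℕ → Equiv.Perm (Fin 3) := fun k => Nat.rec 1 (fun k q => q * step k) k
  have key : ∀ P : Equiv.Perm (Fin 3), ∃ x : ℤˣ,
      (![1, -1, x] : Fin 3 → ℤˣ) (P 1) = -(![1, -1, x] : Fin 3 → ℤˣ) (P 2) ∧
        (![1, -1, x] : Fin 3 → ℤˣ) (P 0) = x := by decide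
  obtain ⟨x, h1, h2⟩ := key (p w.length)
  refine ⟨⟨fun k j => (![1, -1, x] : Fin 3 → ℤˣ) (p k j), ?_, ?_, h1, h2⟩⟩
  · intro k j
    have hs : step k = Equiv.swap (w.get k).top (w.get k).bot := by simp [step]
    change (![1, -1, x] : Fin 3 → ℤˣ) ((p k * step k) j) = _
    rw [hs]
    rfl
  · change (1 : ℤˣ) = -(-1)
    simp

/-- The crossings of the successive boxes of half twists: `a₁` half twists on the lower two strands
with the strand from the lower left to the upper right on top, then `a₂` half twists on the upper
two strands with the strand from the upper left to the lower right on top, and so on alternately.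
The flag tells whether the next box is an upper one. -/
def twists : Bool → List ℕ → List Crossing
  | _, [] => []
  | upper, a :: l =>
      List.replicate a (if upper then ⟨0, true⟩ else ⟨1, false⟩) ++ twists (!upper) l

/-- The standard diagram of the rational link `L(α)`. -/
def rationalLink (α : ℚ) : List Crossing := twists false (evenCF α)

/-! ### The polynomials `J_α` and `I_α` -/

/-- For `f ≠ 0`, the unique polynomial of the form `± q ^ n * f` (`n ∈ ℤ`) with positive constant
term; for `f = 0` it is `0`. -/
noncomputable def unitNormalize (f : ℤ[T;T⁻¹]) : ℤ[X] :=
  let k : ℤ := sInf {n : ℤ | f.coeff n ≠ 0}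
  Polynomial.C (SignType.sign (f.coeff k) : ℤ) * trunc (T (-k) * f)

/-- The normalized Jones polynomial `J_α(q) = ± t ^ (-h) * V(t)` at `t = -q⁻¹`, where `± t ^ h` is
the leading term of the Jones polynomial `V(t)` of `L(α)`. As `t = A ^ (-4)`, the leading term in
`t` is the lowest one in `A`, and `A ^ 4 = -q`. A change of the orientation of the link multiplies
`V(t)` by a power of `t`, so that `J_α` does not depend on it. -/
noncomputable def normalizedJones (α : ℚ) : ℤ[X] :=
  (Polynomial.contract 4 (unitNormalize
    (jones (rationalLink α) (Classical.choice (nonempty_orientation _))))).comp (-X)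

/-- The polynomial `I_α(q)`: it is `± q ^ N * (J_α(q)^∨ - J_α(q)) / (1 - q)`, normalized to be a
polynomial with positive constant term; here `f^∨ = q ^ deg f * f (q⁻¹)`. It is `0` if `J_α` is
palindromic, that is, `J_α^∨ = J_α`. -/
noncomputable def traceJones (α : ℚ) : ℤ[X] :=
  unitNormalize (Polynomial.toLaurent
    (((normalizedJones α).reverse - normalizedJones α) /ₘ (X - 1)))

end QRat

namespace QRat

/-! ### The state sum as a transfer matrix -/

/-! Put q = -A⁴. Resolving the leftmost crossing expresses the state sum of a diagram through those
of the shorter diagram with its left ends closed in two ways. After rescaling one of the two sums by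
A², a lower crossing acts on the pair, up to a unit ±Aⁿ, by `qR q`, and an upper one by `qL q`. The
empty word gives the vector (q - 1, 1). Hence the bracket of L(α) is, up to a unit, M₁₀(q - 1) +
M₁₁, where M is the product of the deformed matrices along the continued fraction
(`exists_bracket_twists`). This polynomial has constant term 1, so it is J_α (`normalizedJones_eq`).

The matrix `flipMatrix q` intertwines the deformations at q and q⁻¹, so J_α^∨ is also a combination
of entries of M (`pow_mul_jonesEntry`). Write M = R_q N L_q, where N belongs to the word with both
end exponents lowered by 1. Then J_α^∨ - J_α = (q - 1)(N₀₁ - q N₁₀), and I_α is the normalization of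
N₀₁ - q N₁₀ (`traceJones_eq`).

Passing from N to R_q N L_q multiplies N₀₁ - q N₁₀ by q (`trace_invariant`), which the normalization
ignores. Thus I_α does not change when the first and the last exponent both grow by i. Classically
this replaces M by RⁱMLⁱ, whose first column is the numerator and denominator of α_i. -/

/-- The arcs of a smoothed diagram as in `Joined`, but with the left ends closed in one of two ways:
for `e = true` the points `(0, 0)` and `(0, 1)` are joined and `(0, 2)` is the end of the arc around
the diagram; for `e = false` the points `(0, 1)` and `(0, 2)` are joined and `(0, 0)` is that end. -/
inductive JoinedFrom (e : Bool) (w : List Crossing) (σ : Fin w.length → Bool) :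
    Point w → Point w → Prop
  | left : JoinedFrom e w σ (0, if e then 0 else 1) (0, if e then 1 else 2)
  | right : JoinedFrom e w σ (Fin.last _, 1) (Fin.last _, 2)
  | back : JoinedFrom e w σ (Fin.last _, 0) (0, if e then 2 else 0)
  | idle (k : Fin w.length) (j : Fin 3) (ht : j ≠ (w.get k).top) (hb : j ≠ (w.get k).bot) :
      JoinedFrom e w σ (k.castSucc, j) (k.succ, j)
  | horizontal_top (k : Fin w.length) (h : σ k = (w.get k).desc) :
      JoinedFrom e w σ (k.castSucc, (w.get k).top) (k.succ, (w.get k).top)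
  | horizontal_bot (k : Fin w.length) (h : σ k = (w.get k).desc) :
      JoinedFrom e w σ (k.castSucc, (w.get k).bot) (k.succ, (w.get k).bot)
  | vertical_left (k : Fin w.length) (h : σ k ≠ (w.get k).desc) :
      JoinedFrom e w σ (k.castSucc, (w.get k).top) (k.castSucc, (w.get k).bot)
  | vertical_right (k : Fin w.length) (h : σ k ≠ (w.get k).desc) :
      JoinedFrom e w σ (k.succ, (w.get k).top) (k.succ, (w.get k).bot)

theorem joinedFrom_true (w : List Crossing) (σ : Fin w.length → Bool) :
    JoinedFrom true w σ = Joined w σ := by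
  funext x y
  refine propext ⟨fun h => ?_, fun h => ?_⟩
  · cases h
    · exact .left
    · exact .right
    · exact .back
    · exact .idle _ _ ‹_› ‹_›
    · exact .horizontal_top _ ‹_›
    · exact .horizontal_bot _ ‹_›
    · exact .vertical_left _ ‹_›
    · exact .vertical_right _ ‹_›
  · cases h
    · exact .left (e := true)
    · exact .right
    · exact .back (e := true)
    · exact .idle _ _ ‹_› ‹_›
    · exact .horizontal_top _ ‹_›
    · exact .horizontal_bot _ ‹_›
    · exact .vertical_left _ ‹_›
    · exact .vertical_right _ ‹_›

/-- The number of loops of a smoothed diagram whose left ends are closed as prescribed by `e`. -/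
noncomputable def loopsFrom (e : Bool) (w : List Crossing) (σ : Fin w.length → Bool) : ℕ :=
  Nat.card (Quot (JoinedFrom e w σ))

theorem loopsFrom_pos (e : Bool) (w : List Crossing) (σ : Fin w.length → Bool) :
    0 < loopsFrom e w σ := by
  have : Nonempty (Quot (JoinedFrom e w σ)) := ⟨Quot.mk _ (0, 0)⟩
  exact Nat.card_pos

/-! ### Effect of smoothing the first crossing on the number of loops -/

theorem card_quot_eq {α β : Type*} {r : α → α → Prop} {r' : β → β → Prop} (f : β → α) (g : α → β)
    (hf : ∀ x y, r' x y → Quot.mk r (f x) = Quot.mk r (f y))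
    (hg : ∀ x y, r x y → Quot.mk r' (g x) = Quot.mk r' (g y))
    (hfg : ∀ x, Quot.mk r (f (g x)) = Quot.mk r x) (hgf : ∀ x, g (f x) = x) :
    Nat.card (Quot r) = Nat.card (Quot r') := by
  refine Nat.card_congr ⟨Quot.lift (fun x => Quot.mk _ (g x)) hg,
    Quot.lift (fun x => Quot.mk _ (f x)) hf, ?_, ?_⟩
  · rintro ⟨x⟩
    exact hfg x
  · rintro ⟨x⟩
    exact congrArg (Quot.mk r') (hgf x)

/-- Here `none` stands for the one additional class, that of `x₀`: the loop that splits off. -/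
theorem card_quot_eq_add_one {α β : Type*} [Finite β] {r : α → α → Prop} {r' : β → β → Prop}
    (f : β → α) (g : α → Option β) (x₀ : α)
    (hf : ∀ x y, r' x y → Quot.mk r (f x) = Quot.mk r (f y))
    (hg : ∀ x y, r x y → (g x).map (Quot.mk r') = (g y).map (Quot.mk r'))
    (hfg : ∀ x, Quot.mk r ((g x).elim x₀ f) = Quot.mk r x) (hgf : ∀ x, g (f x) = some x)
    (h₀ : g x₀ = none) :
    Nat.card (Quot r) = Nat.card (Quot r') + 1 := by
  rw [← Finite.card_option]
  refine Nat.card_congr ⟨Quot.lift (fun x => (g x).map (Quot.mk _)) hg,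
    fun o => o.elim (Quot.mk r x₀) (Quot.lift (fun x : β => Quot.mk r (f x)) hf), ?_, ?_⟩
  · rintro ⟨x⟩
    have := hfg x
    change Option.elim ((g x).map (Quot.mk r')) _ _ = _
    cases h : g x with
    | none => simpa [h] using this
    | some y => simpa [h] using this
  · rintro (_ | q)
    · change (g x₀).map _ = _
      simp [h₀]
    · obtain ⟨x⟩ := q
      change (g (f x)).map _ = _
      simp [hgf]

section

variable (c : Crossing) (w : List Crossing) (σ : Fin (c :: w).length → Bool)

/-- The points of the diagram of `w` as points of the diagram of `c :: w`. -/
def shift (x : Point w) : Point (c :: w) := (x.1.succ, x.2)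

/-- Every arc of the shorter diagram shifts to an arc of the same kind, except the two that end at
its left closure; only these need the hypotheses `hl` and `hb`. -/
theorem mk_shift_eq {e e' : Bool}
    (hl : Quot.mk (JoinedFrom e (c :: w) σ) (1, if e' then 0 else 1) =
      Quot.mk _ (1, if e' then 1 else 2))
    (hb : Quot.mk (JoinedFrom e (c :: w) σ) (0, if e then 2 else 0) =
      Quot.mk _ (1, if e' then 2 else 0))
    (x y : Point w) (h : JoinedFrom e' w (fun k => σ k.succ) x y) :
    Quot.mk (JoinedFrom e (c :: w) σ) (shift c w x) = Quot.mk _ (shift c w y) := by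
  cases h with
  | left => exact hl
  | right => exact Quot.sound .right
  | back => exact (Quot.sound .back).trans hb
  | idle k j ht hb => exact Quot.sound (.idle (w := c :: w) k.succ j ht hb)
  | horizontal_top k h => exact Quot.sound (.horizontal_top (w := c :: w) k.succ h)
  | horizontal_bot k h => exact Quot.sound (.horizontal_bot (w := c :: w) k.succ h)
  | vertical_left k h => exact Quot.sound (.vertical_left (w := c :: w) k.succ h)
  | vertical_right k h => exact Quot.sound (.vertical_right (w := c :: w) k.succ h)

/-- Retraction of the points of the diagram of `c :: w` to those of the diagram of `w`. -/
def retract (g : Fin 3 → Option (Fin 3)) (x : Point (c :: w)) : Option (Point w) :=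
  Fin.cases ((g x.2).map fun j => (0, j)) (fun k => some (k, x.2)) x.1

/-- The map `g` tells where the points of the leftmost column slide to, `none` meaning that they lie
on a loop that splits off. Only arcs touching that column or the first crossing have to be checked.
-/
theorem retract_eq {e e' : Bool} (g : Fin 3 → Option (Fin 3))
    {π : Fin 3 → Quot (JoinedFrom e' w (fun k => σ k.succ))} (hπ : π = fun j => Quot.mk _ (0, j))
    (hl : (g (if e then 0 else 1)).map π = (g (if e then 1 else 2)).map π)
    (hb : some (π (if e' then 2 else 0)) = (g (if e then 2 else 0)).map π)
    (hi : ∀ j, j ≠ c.top → j ≠ c.bot → (g j).map π = some (π j))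
    (hht : σ 0 = c.desc → (g c.top).map π = some (π c.top))
    (hhb : σ 0 = c.desc → (g c.bot).map π = some (π c.bot))
    (hvl : σ 0 ≠ c.desc → (g c.top).map π = (g c.bot).map π)
    (hvr : σ 0 ≠ c.desc → π c.top = π c.bot)
    (x y : Point (c :: w)) (h : JoinedFrom e (c :: w) σ x y) :
    (retract c w g x).map (Quot.mk (JoinedFrom e' w (fun k => σ k.succ))) =
      (retract c w g y).map (Quot.mk _) := by
  have h0 : ∀ j, (retract c w g (0, j)).map (Quot.mk (JoinedFrom e' w (fun k => σ k.succ))) =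
      (g j).map π := by
    intro j
    subst hπ
    change ((g j).map _).map _ = _
    rw [Option.map_map]
    rfl
  have h1 : ∀ j, (retract c w g (1, j)).map (Quot.mk (JoinedFrom e' w (fun k => σ k.succ))) =
      some (π j) := by
    intro j
    subst hπ
    rfl
  cases h with
  | left => rw [h0, h0, hl]
  | right => exact congrArg some (Quot.sound .right)
  | back =>
    rw [h0, ← hb, hπ]
    exact congrArg some (Quot.sound .back)
  | idle k j ht hb =>
    cases k using Fin.cases with
    | zero => exact (h0 j).trans ((hi j ht hb).trans (h1 j).symm)
    | succ k => exact congrArg some (Quot.sound (.idle k j ht hb))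
  | horizontal_top k h =>
    cases k using Fin.cases with
    | zero => exact (h0 _).trans ((hht h).trans (h1 _).symm)
    | succ k => exact congrArg some (Quot.sound (.horizontal_top k h))
  | horizontal_bot k h =>
    cases k using Fin.cases with
    | zero => exact (h0 _).trans ((hhb h).trans (h1 _).symm)
    | succ k => exact congrArg some (Quot.sound (.horizontal_bot k h))
  | vertical_left k h =>
    cases k using Fin.cases with
    | zero => exact (h0 _).trans ((hvl h).trans (h0 _).symm)
    | succ k => exact congrArg some (Quot.sound (.vertical_left k h))
  | vertical_right k h =>
    cases k using Fin.cases with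
    | zero => exact (h1 _).trans ((congrArg some (hvr h)).trans (h1 _).symm)
    | succ k => exact congrArg some (Quot.sound (.vertical_right k h))

theorem loopsFrom_cons_eq {e e' : Bool} (g : Fin 3 → Fin 3)
    {π : Fin 3 → Quot (JoinedFrom e' w (fun k => σ k.succ))} (hπ : π = fun j => Quot.mk _ (0, j))
    {ρ₀ ρ₁ : Fin 3 → Quot (JoinedFrom e (c :: w) σ)} (hρ₀ : ρ₀ = fun j => Quot.mk _ (0, j))
    (hρ₁ : ρ₁ = fun j => Quot.mk _ (1, j))
    (hl' : ρ₁ (if e' then 0 else 1) = ρ₁ (if e' then 1 else 2))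
    (hb' : ρ₀ (if e then 2 else 0) = ρ₁ (if e' then 2 else 0))
    (h' : ∀ j, ρ₁ (g j) = ρ₀ j)
    (hl : π (g (if e then 0 else 1)) = π (g (if e then 1 else 2)))
    (hb : π (if e' then 2 else 0) = π (g (if e then 2 else 0)))
    (hi : ∀ j, j ≠ c.top → j ≠ c.bot → π (g j) = π j)
    (hht : σ 0 = c.desc → π (g c.top) = π c.top)
    (hhb : σ 0 = c.desc → π (g c.bot) = π c.bot)
    (hvl : σ 0 ≠ c.desc → π (g c.top) = π (g c.bot))
    (hvr : σ 0 ≠ c.desc → π c.top = π c.bot) :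
    loopsFrom e (c :: w) σ = loopsFrom e' w (fun k => σ k.succ) := by
  have hr : ∀ x : Point (c :: w), ∃ y, retract c w (fun j => some (g j)) x = some y := by
    rintro ⟨k, j⟩
    cases k using Fin.cases with
    | zero => exact ⟨_, rfl⟩
    | succ k => exact ⟨_, rfl⟩
  choose G hG using hr
  refine card_quot_eq (shift c w) G (mk_shift_eq c w σ ?_ ?_) (fun x y h => ?_) ?_ ?_
  · subst hρ₁; exact hl'
  · subst hρ₀ hρ₁; exact hb'
  · have := retract_eq c w σ (fun j => some (g j)) hπ (by simpa using hl) (by simpa using hb)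
      (by simpa using hi) (by simpa using hht) (by simpa using hhb) (by simpa using hvl)
      (by simpa using hvr) x y h
    rw [hG, hG] at this
    simpa using this
  · rintro ⟨k, j⟩
    cases k using Fin.cases with
    | zero =>
      have : G (0, j) = (0, g j) := Option.some_injective _ (hG _).symm
      rw [this]
      subst hρ₀ hρ₁
      exact h' j
    | succ k =>
      have : G (k.succ, j) = (k, j) := Option.some_injective _ (hG _).symm
      rw [this]
      rfl
  · intro x
    exact Option.some_injective _ (hG _).symm

theorem loopsFrom_cons_horizontal (e : Bool) (h : σ 0 = c.desc) :
    loopsFrom e (c :: w) σ = loopsFrom e w (fun k => σ k.succ) := by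
  have key : ∀ j, Quot.mk (JoinedFrom e (c :: w) σ) (1, j) = Quot.mk _ (0, j) := by
    intro j
    by_cases ht : j = c.top
    · subst ht; exact (Quot.sound (.horizontal_top (w := c :: w) 0 h)).symm
    by_cases hb : j = c.bot
    · subst hb; exact (Quot.sound (.horizontal_bot (w := c :: w) 0 h)).symm
    · exact (Quot.sound (.idle (w := c :: w) 0 j ht hb)).symm
  refine loopsFrom_cons_eq c w σ id rfl rfl rfl ?_ ?_ key ?_ rfl (fun _ _ _ => rfl) (fun _ => rfl)
    (fun _ => rfl) (fun h' => (h' h).elim) (fun h' => (h' h).elim)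
  · exact (key _).trans ((Quot.sound .left).trans (key _).symm)
  · exact (key _).symm
  · exact Quot.sound .left

theorem loopsFrom_cons_vertical_of_ne (b e : Bool) (h : σ 0 ≠ c.desc)
    (hc : c.pos = if b then 0 else 1) (hbe : b ≠ e) :
    loopsFrom e (c :: w) σ = loopsFrom b w (fun k => σ k.succ) := by
  obtain ⟨p, d⟩ := c
  obtain rfl : e = !b := by cases b <;> cases e <;> simp_all
  have hv : Quot.mk (JoinedFrom (!b) (⟨p, d⟩ :: w) σ) (0, p.castSucc) = Quot.mk _ (0, p.succ) :=
    Quot.sound (.vertical_left (w := ⟨p, d⟩ :: w) 0 h)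
  have hv' : Quot.mk (JoinedFrom (!b) (⟨p, d⟩ :: w) σ) (1, p.castSucc) = Quot.mk _ (1, p.succ) :=
    Quot.sound (.vertical_right (w := ⟨p, d⟩ :: w) 0 h)
  have hleft := Quot.sound (JoinedFrom.left (e := !b) (w := ⟨p, d⟩ :: w) (σ := σ))
  have hleft' := Quot.sound (JoinedFrom.left (e := b) (w := w) (σ := fun k => σ k.succ))
  have hidle : ∀ j, j ≠ p.castSucc → j ≠ p.succ →
      Quot.mk (JoinedFrom (!b) (⟨p, d⟩ :: w) σ) (0, j) = Quot.mk _ (1, j) := fun j h1 h2 =>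
    Quot.sound (.idle (w := ⟨p, d⟩ :: w) 0 j h1 h2)
  cases b
  · obtain rfl : p = 1 := hc
    have h0 := hidle 0 (by decide) (by decide)
    -- The left closure and the cup put the whole left column on one arc, which continues along the
    -- idle strand 0; so every point slides there. In the other case the idle strand is 2.
    refine loopsFrom_cons_eq _ w σ (fun _ => 0) rfl rfl rfl hv' ?_ ?_ rfl rfl ?_
      (fun h' => (h h').elim) (fun h' => (h h').elim) (fun _ => rfl) (fun _ => hleft')
    · exact hv.symm.trans (hleft.symm.trans h0)
    · intro j
      fin_cases j
      · exact h0.symm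
      · exact h0.symm.trans hleft
      · exact h0.symm.trans (hleft.trans hv)
    · intro j
      fin_cases j <;> simp [Crossing.top, Crossing.bot]
  · obtain rfl : p = 0 := hc
    have h0 := hidle 2 (by decide) (by decide)
    refine loopsFrom_cons_eq _ w σ (fun _ => 2) rfl rfl rfl hv' ?_ ?_ rfl rfl ?_
      (fun h' => (h h').elim) (fun h' => (h h').elim) (fun _ => rfl) (fun _ => hleft')
    · exact hv.trans (hleft.trans h0)
    · intro j
      fin_cases j
      · exact h0.symm.trans (hleft.symm.trans hv.symm)
      · exact h0.symm.trans hleft.symm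
      · exact h0.symm
    · intro j
      fin_cases j <;> simp [Crossing.top, Crossing.bot]

/-- The cup meets the left closure at both ends and forms a separate loop, while the cap on its
right takes over the role of the closure. -/
theorem loopsFrom_cons_vertical_self (e : Bool) (h : σ 0 ≠ c.desc)
    (hc : c.pos = if e then 0 else 1) :
    loopsFrom e (c :: w) σ = loopsFrom e w (fun k => σ k.succ) + 1 := by
  obtain ⟨p, d⟩ := c
  have hv : Quot.mk (JoinedFrom e (⟨p, d⟩ :: w) σ) (0, p.castSucc) = Quot.mk _ (0, p.succ) :=
    Quot.sound (.vertical_left (w := ⟨p, d⟩ :: w) 0 h)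
  have hv' : Quot.mk (JoinedFrom e (⟨p, d⟩ :: w) σ) (1, p.castSucc) = Quot.mk _ (1, p.succ) :=
    Quot.sound (.vertical_right (w := ⟨p, d⟩ :: w) 0 h)
  have hleft' := Quot.sound (JoinedFrom.left (e := e) (w := w) (σ := fun k => σ k.succ))
  have hidle : ∀ j, j ≠ p.castSucc → j ≠ p.succ →
      Quot.mk (JoinedFrom e (⟨p, d⟩ :: w) σ) (0, j) = Quot.mk _ (1, j) := fun j h1 h2 =>
    Quot.sound (.idle (w := ⟨p, d⟩ :: w) 0 j h1 h2)
  refine card_quot_eq_add_one (shift _ w)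
    (retract _ w fun j => if j = p.castSucc ∨ j = p.succ then none else some j) (0, p.castSucc)
    (mk_shift_eq _ w σ ?_ ?_) (retract_eq _ w σ _ rfl ?_ ?_ ?_ (fun h' => (h h').elim)
      (fun h' => (h h').elim) (fun _ => ?_) (fun _ => ?_)) ?_ (fun _ => rfl) ?_
  · cases e <;> obtain rfl : p = _ := hc <;> exact hv'
  · cases e <;> obtain rfl : p = _ := hc
    · exact hidle 0 (by decide) (by decide)
    · exact hidle 2 (by decide) (by decide)
  · cases e <;> obtain rfl : p = _ := hc <;> rfl
  · cases e <;> obtain rfl : p = _ := hc <;> rfl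
  · intro j h1 h2
    change j ≠ p.castSucc at h1
    change j ≠ p.succ at h2
    simp [h1, h2]
  · simp [Crossing.top, Crossing.bot]
  · cases e <;> obtain rfl : p = _ := hc <;> exact hleft'
  · rintro ⟨k, j⟩
    cases k using Fin.cases with
    | zero =>
      change Quot.mk _ (Option.elim (Option.map _ (if j = p.castSucc ∨ j = p.succ then none
        else some j)) _ _) = _
      split_ifs with hj
      · rcases hj with rfl | rfl
        · rfl
        · exact hv
      · push Not at hj
        exact (hidle j hj.1 hj.2).symm
    | succ k => rfl
  · change Option.map _ (if p.castSucc = p.castSucc ∨ p.castSucc = p.succ then none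
        else some p.castSucc) = _
    simp

/-! ### Recursion for the two state sums -/

/-- The state sum of a diagram whose left ends are closed as prescribed by `e`. -/
noncomputable def bracketFrom (e : Bool) (w : List Crossing) : ℤ[T;T⁻¹] :=
  ∑ σ : Fin w.length → Bool,
    T (∑ k, if σ k then (1 : ℤ) else -1) * (-T 2 - T (-2)) ^ (loopsFrom e w σ - 1)

theorem bracketFrom_true (w : List Crossing) : bracketFrom true w = bracket w := by
  simp only [bracketFrom, bracket, loopsFrom, loops, joinedFrom_true]

theorem bracketFrom_true_nil : bracketFrom true [] = 1 := by
  have h : ∀ σ, loopsFrom true [] σ = 1 := by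
    intro σ
    refine Nat.card_eq_one_iff_unique.2 ⟨⟨?_⟩, ⟨Quot.mk _ (0, 0)⟩⟩
    have key : ∀ x, x = Quot.mk (JoinedFrom true [] σ) (0, 1) := by
      rintro ⟨k, j⟩
      obtain rfl : k = 0 := Subsingleton.elim (α := Fin 1) _ _
      fin_cases j
      · exact Quot.sound (.left (e := true))
      · rfl
      · exact (Quot.sound .right).symm
    intro x y
    rw [key x, key y]
  refine (Fintype.sum_unique (ι := Fin 0 → Bool) _).trans ?_
  rw [h]
  simp

theorem bracketFrom_false_nil : bracketFrom false [] = -T 2 - T (-2) := by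
  have h : ∀ σ, loopsFrom false [] σ = 2 := by
    intro σ
    rw [← Nat.card_eq_fintype_card (α := Fin 2) |>.trans (Fintype.card_fin 2)]
    refine Nat.card_congr ⟨Quot.lift (fun x => if x.2 = 0 then (0 : Fin 2) else 1) ?_,
      fun i => Quot.mk _ (0, i.castSucc), ?_, ?_⟩
    · rintro x y (_ | _ | _ | ⟨k, _⟩ | ⟨k, _⟩ | ⟨k, _⟩ | ⟨k, _⟩ | ⟨k, _⟩)
      · rfl
      · rfl
      · rfl
      all_goals exact k.elim0
    · rintro ⟨k, j⟩
      obtain rfl : k = 0 := Subsingleton.elim (α := Fin 1) _ _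
      fin_cases j
      · rfl
      · rfl
      · exact Quot.sound .right
    · intro i
      fin_cases i <;> rfl
  refine (Fintype.sum_unique (ι := Fin 0 → Bool) _).trans ?_
  rw [h]
  simp

theorem bracketFrom_cons (e : Bool) :
    bracketFrom e (c :: w) = ∑ b : Bool, T (if b then 1 else -1) *
      ∑ σ : Fin w.length → Bool, T (∑ k, if σ k then (1 : ℤ) else -1) *
        (-T 2 - T (-2)) ^ (loopsFrom e (c :: w) (Fin.cons (α := fun _ => Bool) b σ) - 1) := by
  refine ((Fin.consEquiv (n := w.length) (fun _ => Bool)).sum_comp _).symm.trans ?_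
  rw [Fintype.sum_prod_type]
  refine Finset.sum_congr rfl fun b _ => ?_
  rw [Finset.mul_sum]
  refine Finset.sum_congr rfl fun σ _ => ?_
  rw [← mul_assoc, ← T_add]
  congr 2
  exact Fin.sum_univ_succ _

theorem sum_horizontal (e b : Bool) (h : b = c.desc) :
    ∑ σ : Fin w.length → Bool, T (∑ k, if σ k then (1 : ℤ) else -1) *
        (-T 2 - T (-2)) ^ (loopsFrom e (c :: w) (Fin.cons (α := fun _ => Bool) b σ) - 1) =
      bracketFrom e w := by
  refine Finset.sum_congr rfl fun σ _ => ?_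
  rw [loopsFrom_cons_horizontal c w _ e h]
  rfl

theorem sum_vertical_of_ne (e e' b : Bool) (h : b ≠ c.desc) (hc : c.pos = if e' then 0 else 1)
    (he : e' ≠ e) :
    ∑ σ : Fin w.length → Bool, T (∑ k, if σ k then (1 : ℤ) else -1) *
        (-T 2 - T (-2)) ^ (loopsFrom e (c :: w) (Fin.cons (α := fun _ => Bool) b σ) - 1) =
      bracketFrom e' w := by
  refine Finset.sum_congr rfl fun σ _ => ?_
  rw [loopsFrom_cons_vertical_of_ne c w _ e' e h hc he]
  rfl

theorem sum_vertical_self (e b : Bool) (h : b ≠ c.desc) (hc : c.pos = if e then 0 else 1) :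
    ∑ σ : Fin w.length → Bool, T (∑ k, if σ k then (1 : ℤ) else -1) *
        (-T 2 - T (-2)) ^ (loopsFrom e (c :: w) (Fin.cons (α := fun _ => Bool) b σ) - 1) =
      (-T 2 - T (-2)) * bracketFrom e w := by
  rw [bracketFrom, Finset.mul_sum]
  refine Finset.sum_congr rfl fun σ _ => ?_
  rw [loopsFrom_cons_vertical_self c w _ e h hc]
  -- The exponent `loopsFrom - 1` is a truncated subtraction, so positivity is needed for one more
  -- loop to give one more factor.
  obtain ⟨n, hn⟩ := Nat.exists_eq_add_of_lt (loopsFrom_pos e w σ)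
  change _ * _ ^ (loopsFrom e w σ + 1 - 1) = _
  rw [hn]
  simp only [zero_add, Nat.add_sub_cancel, pow_succ]
  ring

theorem bracketFrom_true_upper : bracketFrom true (⟨0, true⟩ :: w) =
    (T 1 + T (-1) * (-T 2 - T (-2))) * bracketFrom true w := by
  rw [bracketFrom_cons, Fintype.sum_bool, sum_horizontal _ _ _ _ rfl,
    sum_vertical_self _ _ _ _ (by decide) rfl]
  simp only [if_true, Bool.false_eq_true, if_false]
  ring

theorem bracketFrom_false_upper : bracketFrom false (⟨0, true⟩ :: w) =
    T 1 * bracketFrom false w + T (-1) * bracketFrom true w := by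
  rw [bracketFrom_cons, Fintype.sum_bool, sum_horizontal _ _ _ _ rfl,
    sum_vertical_of_ne _ _ _ true _ (by decide) rfl (by decide)]
  simp

theorem bracketFrom_true_lower : bracketFrom true (⟨1, false⟩ :: w) =
    T (-1) * bracketFrom true w + T 1 * bracketFrom false w := by
  rw [bracketFrom_cons, Fintype.sum_bool, sum_horizontal _ _ _ _ rfl,
    sum_vertical_of_ne _ _ _ false _ (by decide) rfl (by decide)]
  simp [add_comm]

theorem bracketFrom_false_lower : bracketFrom false (⟨1, false⟩ :: w) =
    (T (-1) + T 1 * (-T 2 - T (-2))) * bracketFrom false w := by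
  rw [bracketFrom_cons, Fintype.sum_bool, sum_horizontal _ _ _ _ rfl,
    sum_vertical_self _ _ _ _ (by decide) rfl]
  simp only [if_true, Bool.false_eq_true, if_false]
  ring

end

/-! ### Alternating products -/

/-- The alternating product `x ^ a₁ * y ^ a₂ * x ^ a₃ * ⋯`. -/
def altProd {M : Type*} [Monoid M] : M → M → List ℕ → M
  | _, _, [] => 1
  | x, y, a :: l => x ^ a * altProd y x l

theorem map_altProd {M N : Type*} [Monoid M] [Monoid N] (f : M →* N) (x y : M) (l : List ℕ) :
    f (altProd x y l) = altProd (f x) (f y) l := by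
  induction l generalizing x y with
  | nil => simp [altProd]
  | cons a l ih => simp [altProd, ih]

theorem altProd_append {M : Type*} [Monoid M] (x y : M) :
    ∀ l m : List ℕ, Even l.length → altProd x y (l ++ m) = altProd x y l * altProd x y m
  | [], m, _ => by simp [altProd]
  | [_], _, h => by simp at h
  | a :: b :: l, m, h => by
    have hl : Even l.length := by simpa [Nat.even_add_one] using h
    simp [altProd, altProd_append x y l m hl, mul_assoc]

/-- Even length of the middle part makes the last block a power of `y`, so the additional factors
come out at opposite ends. -/
theorem altProd_add_ends {M : Type*} [Monoid M] (x y : M) (a b i : ℕ) (l : List ℕ)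
    (hl : Even l.length) :
    altProd x y ((a + i) :: (l ++ [b + i])) = x ^ i * altProd x y (a :: (l ++ [b])) * y ^ i := by
  simp only [altProd, altProd_append _ _ l _ hl, add_comm a, pow_add, mul_assoc, mul_one]

theorem cfMatrix_eq_altProd : ∀ l : List ℕ,
    cfMatrix l = altProd (!![1, 1; 0, 1] : Matrix (Fin 2) (Fin 2) ℤ) !![1, 0; 1, 1] l
  | [] => rfl
  | [a] => by simp [cfMatrix, altProd]
  | a :: b :: l => by simp [cfMatrix, altProd, cfMatrix_eq_altProd l, mul_assoc]

/-! ### The deformed matrices and the Kauffman bracket -/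

section

variable {A : Type*} [CommRing A]

/-- The deformation of `R` acting on state sums. -/
def qR (q : A) : Matrix (Fin 2) (Fin 2) A := !![q, 0; 1, 1]

/-- The deformation of `L` acting on state sums. -/
def qL (q : A) : Matrix (Fin 2) (Fin 2) A := !![q, q; 0, 1]

/-- The polynomial that the deformed matrix `N` of a rational link contributes to the state sum. -/
def jonesEntry (q : A) (N : Matrix (Fin 2) (Fin 2) A) : A := N 1 0 * (q - 1) + N 1 1

theorem map_qR {B : Type*} [CommRing B] (f : A →+* B) (q : A) : f.mapMatrix (qR q) = qR (f q) := by
  ext i j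
  fin_cases i <;> fin_cases j <;> simp [qR]

theorem map_qL {B : Type*} [CommRing B] (f : A →+* B) (q : A) : f.mapMatrix (qL q) = qL (f q) := by
  ext i j
  fin_cases i <;> fin_cases j <;> simp [qL]

theorem jonesEntry_map {B : Type*} [CommRing B] (f : A →+* B) (q : A) (l : List ℕ) :
    f (jonesEntry q (altProd (qR q) (qL q) l)) =
      jonesEntry (f q) (altProd (qR (f q)) (qL (f q)) l) := by
  have h := map_altProd (f.mapMatrix : Matrix (Fin 2) (Fin 2) A →+* _).toMonoidHom (qR q) (qL q) l
  change f.mapMatrix _ = altProd (f.mapMatrix _) (f.mapMatrix _) l at h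
  rw [map_qR, map_qL] at h
  rw [← h]
  simp [jonesEntry]

/-- The matrix that intertwines the deformations at `q` and at `q⁻¹`. -/
def flipMatrix (q : A) : Matrix (Fin 2) (Fin 2) A := !![1, 1 - q; q - 1, q]

theorem flipMatrix_mul_qR {p q : A} (h : q * p = 1) :
    flipMatrix q * qR q = q • (qR p * flipMatrix q) := by
  ext i j
  fin_cases i <;> fin_cases j <;> simp [flipMatrix, qR]
  all_goals first | ring1 | linear_combination -h | linear_combination (q - 1) * h

theorem flipMatrix_mul_qL {p q : A} (h : q * p = 1) :
    flipMatrix q * qL q = q • (qL p * flipMatrix q) := by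
  ext i j
  fin_cases i <;> fin_cases j <;> simp [flipMatrix, qL]
  all_goals first | ring1 | linear_combination -h | linear_combination -q * h

/-- The flip matrix moves past the letters one by one, each contributing a factor `q`; their number
is `l.sum`. No inverse of it is needed. -/
theorem flipMatrix_mul_altProd {q : A} {x y x' y' : Matrix (Fin 2) (Fin 2) A}
    (hx : flipMatrix q * x = q • (x' * flipMatrix q))
    (hy : flipMatrix q * y = q • (y' * flipMatrix q)) (l : List ℕ) :
    flipMatrix q * altProd x y l = q ^ l.sum • (altProd x' y' l * flipMatrix q) := by
  have hpow : ∀ (x x' : Matrix (Fin 2) (Fin 2) A)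
      (_ : flipMatrix q * x = q • (x' * flipMatrix q)) (a : ℕ),
      flipMatrix q * x ^ a = q ^ a • (x' ^ a * flipMatrix q) := by
    intro x x' hx a
    induction a with
    | zero => simp
    | succ a ih =>
      rw [pow_succ, ← mul_assoc, ih, smul_mul_assoc, mul_assoc, hx, mul_smul_comm, smul_smul,
        ← pow_succ, ← mul_assoc, ← pow_succ]
  induction l generalizing x y x' y' with
  | nil => simp [altProd]
  | cons a l ih =>
    rw [altProd, altProd, ← mul_assoc, hpow x x' hx, smul_mul_assoc, mul_assoc, ih hy hx,
      mul_smul_comm, smul_smul, ← pow_add, List.sum_cons, mul_assoc]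

/-- The second column of `flipMatrix q` is (1 - q, q) = q(p - 1, 1), that is, `q` times the boundary
vector at `p = q⁻¹`. So the (1, 1) entry of the intertwining relation contains `jonesEntry p`. -/
theorem pow_mul_jonesEntry {p q : A} (h : q * p = 1) (l : List ℕ) :
    q * (q ^ l.sum * jonesEntry p (altProd (qR p) (qL p) l)) =
      altProd (qR q) (qL q) l 0 1 * (q - 1) + q * altProd (qR q) (qL q) l 1 1 := by
  have key := congrFun (congrFun (flipMatrix_mul_altProd
    (flipMatrix_mul_qR h) (flipMatrix_mul_qL h) l) 1) 1
  generalize altProd (qR q) (qL q) l = N at key ⊢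
  generalize altProd (qR p) (qL p) l = N' at key ⊢
  simp only [flipMatrix, Matrix.mul_apply, Matrix.smul_apply, Fin.sum_univ_two, Matrix.of_apply,
    Matrix.cons_val', Matrix.cons_val_zero, Matrix.cons_val_one, Matrix.cons_val_fin_one,
    smul_eq_mul] at key
  rw [jonesEntry]
  linear_combination -key + q ^ l.sum * N' 1 0 * h

theorem qR_mul_mul_qL (q : A) (N : Matrix (Fin 2) (Fin 2) A) :
    qR q * N * qL q = !![q ^ 2 * N 0 0, q ^ 2 * N 0 0 + q * N 0 1;
      q * (N 0 0 + N 1 0), q * (N 0 0 + N 1 0) + N 0 1 + N 1 1] := by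
  ext i j
  fin_cases i <;> fin_cases j <;> simp [qR, qL, Matrix.mul_apply, Matrix.vecMul, dotProduct,
    Fin.sum_univ_two] <;> ring

theorem trace_invariant (q : A) (N : Matrix (Fin 2) (Fin 2) A) (i : ℕ) :
    (qR q ^ i * N * qL q ^ i) 0 1 - q * (qR q ^ i * N * qL q ^ i) 1 0 =
      q ^ i * (N 0 1 - q * N 1 0) := by
  induction i with
  | zero => simp
  | succ i ih =>
    have : qR q ^ (i + 1) * N * qL q ^ (i + 1) = qR q * (qR q ^ i * N * qL q ^ i) * qL q := by
      rw [pow_succ', pow_succ]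
      simp only [mul_assoc]
    rw [this, qR_mul_mul_qL]
    simp
    linear_combination q * ih

end

/-- The two state sums of a diagram, with the left ends closed in the two possible ways. -/
noncomputable def bracketVec (w : List Crossing) : Fin 2 → ℤ[T;T⁻¹] :=
  ![T 2 * bracketFrom false w, bracketFrom true w]

theorem bracketVec_nil : bracketVec [] = ![-T 4 - 1, 1] := by
  rw [bracketVec, bracketFrom_false_nil, bracketFrom_true_nil]
  simp only [mul_sub, mul_neg, ← T_add]
  norm_num

/-- The factor `T 2` in `bracketVec` is chosen so that, after extracting a unit, both crossing
matrices have entries depending only on q = -A⁴. -/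
theorem bracketVec_lower (w : List Crossing) :
    bracketVec (⟨1, false⟩ :: w) =
      (LaurentPolynomial.C 1 * T (-1) : ℤ[T;T⁻¹]) • (qR (-T 4)).mulVec (bracketVec w) := by
  have h4 : (T 4 : ℤ[T;T⁻¹]) = T 1 * T 1 * T 1 * T 1 := by simp only [← T_add]; norm_num
  have h2 : (T 2 : ℤ[T;T⁻¹]) = T 1 * T 1 := by simp only [← T_add]; norm_num
  have h2' : (T (-2) : ℤ[T;T⁻¹]) = T (-1) * T (-1) := by simp only [← T_add]; norm_num
  have h : (T 1 * T (-1) : ℤ[T;T⁻¹]) = 1 := by simp only [← T_add]; norm_num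
  ext1 i
  fin_cases i
  · simp [bracketVec, qR, -mul_T_assoc]
    rw [bracketFrom_false_lower, h4, h2, h2']
    linear_combination (T 1 ^ 5 - T 1 ^ 2 * T (-1)) * bracketFrom false w * h
  · simp [bracketVec, qR, -mul_T_assoc]
    rw [bracketFrom_true_lower, h2]
    linear_combination -T 1 * bracketFrom false w * h

theorem bracketVec_upper (w : List Crossing) :
    bracketVec (⟨0, true⟩ :: w) =
      (LaurentPolynomial.C (-1) * T (-3) : ℤ[T;T⁻¹]) • (qL (-T 4)).mulVec (bracketVec w) := by
  have h4 : (T 4 : ℤ[T;T⁻¹]) = T 1 * T 1 * T 1 * T 1 := by simp only [← T_add]; norm_num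
  have h2 : (T 2 : ℤ[T;T⁻¹]) = T 1 * T 1 := by simp only [← T_add]; norm_num
  have h2' : (T (-2) : ℤ[T;T⁻¹]) = T (-1) * T (-1) := by simp only [← T_add]; norm_num
  have h3' : (T (-3) : ℤ[T;T⁻¹]) = T (-1) * T (-1) * T (-1) := by
    simp only [← T_add]; norm_num
  have h : (T 1 * T (-1) : ℤ[T;T⁻¹]) = 1 := by simp only [← T_add]; norm_num
  ext1 i
  fin_cases i
  · simp [bracketVec, qL, -mul_T_assoc]
    rw [bracketFrom_false_upper, h4, h2, h3']
    linear_combination (-T 1 ^ 3 * bracketFrom false w * (1 + T 1 * T (-1) + T 1 ^ 2 * T (-1) ^ 2) -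
      T 1 ^ 2 * T (-1) * bracketFrom true w * (1 + T 1 * T (-1))) * h
  · simp [bracketVec, qL, -mul_T_assoc]
    rw [bracketFrom_true_upper, h2, h2', h3']
    linear_combination -T 1 * bracketFrom true w * h

/-- `f` is equal to `g` up to a unit `± T n`. -/
def UnitScaled (f g : Fin 2 → ℤ[T;T⁻¹]) : Prop :=
  ∃ (ε : ℤˣ) (n : ℤ), f = (LaurentPolynomial.C (ε : ℤ) * T n : ℤ[T;T⁻¹]) • g

theorem UnitScaled.trans_mulVec {f g h : Fin 2 → ℤ[T;T⁻¹]}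
    {M : Matrix (Fin 2) (Fin 2) ℤ[T;T⁻¹]} (h₁ : UnitScaled f (M.mulVec g))
    (h₂ : UnitScaled g h) : UnitScaled f (M.mulVec h) := by
  obtain ⟨ε, n, rfl⟩ := h₁
  obtain ⟨δ, m, rfl⟩ := h₂
  refine ⟨ε * δ, n + m, ?_⟩
  rw [Matrix.mulVec_smul, smul_smul, Units.val_mul, map_mul, T_add]
  congr 1
  ring

theorem unitScaled_replicate (c : Crossing) (M : Matrix (Fin 2) (Fin 2) ℤ[T;T⁻¹])
    (h : ∀ w, UnitScaled (bracketVec (c :: w)) (M.mulVec (bracketVec w))) (a : ℕ)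
    (w : List Crossing) :
    UnitScaled (bracketVec (List.replicate a c ++ w)) ((M ^ a).mulVec (bracketVec w)) := by
  induction a with
  | zero => exact ⟨1, 0, by simp⟩
  | succ a ih =>
    rw [pow_succ', ← Matrix.mulVec_mulVec]
    exact (h _).trans_mulVec ih

theorem unitScaled_twists (l : List ℕ) (upper : Bool) :
    UnitScaled (bracketVec (twists upper l))
      ((altProd (if upper then qL (-T 4) else qR (-T 4)) (if upper then qR (-T 4) else qL (-T 4))
        l).mulVec (bracketVec [])) := by
  induction l generalizing upper with
  | nil => exact ⟨1, 0, by simp [twists, altProd]⟩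
  | cons a l ih =>
    rw [twists, altProd, ← Matrix.mulVec_mulVec]
    refine UnitScaled.trans_mulVec (unitScaled_replicate _ _ (fun w => ?_) a _) ?_
    · cases upper
      · exact ⟨1, -1, bracketVec_lower w⟩
      · exact ⟨-1, -3, bracketVec_upper w⟩
    · have := ih (!upper)
      cases upper <;> exact this

theorem exists_bracket_twists (l : List ℕ) : ∃ (ε : ℤˣ) (n : ℤ), bracket (twists false l) =
    LaurentPolynomial.C (ε : ℤ) * T n *
      jonesEntry (-T 4) (altProd (qR (-T 4)) (qL (-T 4)) l) := by
  obtain ⟨ε, n, h⟩ := unitScaled_twists l false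
  refine ⟨ε, n, ?_⟩
  have h1 := congrFun h 1
  rw [bracketVec_nil] at h1
  simp only [Bool.false_eq_true, if_false] at h1
  rw [← bracketFrom_true]
  refine h1.trans ?_
  simp [jonesEntry]

/-! ### Normalization -/

theorem unitNormalize_eq {f : ℤ[T;T⁻¹]} {k : ℤ} (h : IsLeast {n : ℤ | f.coeff n ≠ 0} k) :
    unitNormalize f =
      Polynomial.C (SignType.sign (f.coeff k) : ℤ) * trunc (T (-k) * f) := by
  rw [unitNormalize, h.csInf_eq]

theorem exists_isLeast_coeff_ne_zero {f : ℤ[T;T⁻¹]} (hf : f ≠ 0) :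
    ∃ k, IsLeast {n : ℤ | f.coeff n ≠ 0} k := by
  have hne : f.coeff.support.Nonempty := by
    rw [Finsupp.support_nonempty_iff]
    intro h
    exact hf (LaurentPolynomial.ext fun n => by rw [h]; rfl)
  refine ⟨f.coeff.support.min' hne, ?_⟩
  have := f.coeff.support.isLeast_min' hne
  simpa [IsLeast, lowerBounds] using this

theorem coeff_C_mul_T_mul (a n m : ℤ) (f : ℤ[T;T⁻¹]) :
    (LaurentPolynomial.C a * T n * f).coeff m = a * f.coeff (m - n) := by
  rw [← LaurentPolynomial.single_eq_C_mul_T, AddMonoidAlgebra.coeff_single_mul_apply,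
    neg_add_eq_sub]

/-- The lowest exponent moves by `n` and the lowest coefficient changes by the sign `ε`; the
normalization compensates for both. -/
theorem unitNormalize_unit_mul (ε : ℤˣ) (n : ℤ) (f : ℤ[T;T⁻¹]) :
    unitNormalize (LaurentPolynomial.C (ε : ℤ) * T n * f) = unitNormalize f := by
  rcases eq_or_ne f 0 with rfl | hf
  · rw [mul_zero]
  obtain ⟨k, hk⟩ := exists_isLeast_coeff_ne_zero hf
  have hk' : IsLeast {m : ℤ | (LaurentPolynomial.C (ε : ℤ) * T n * f).coeff m ≠ 0} (k + n) := by
    simp only [coeff_C_mul_T_mul, mul_ne_zero_iff]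
    refine ⟨⟨ε.ne_zero, by simpa using hk.1⟩, fun m hm => ?_⟩
    have := hk.2 hm.2
    omega
  rw [unitNormalize_eq hk', unitNormalize_eq hk, coeff_C_mul_T_mul, add_sub_cancel_right]
  have : T (-(k + n)) * (LaurentPolynomial.C (ε : ℤ) * T n * f) = (ε : ℤ) • (T (-k) * f) := by
    rw [LaurentPolynomial.smul_eq_C_mul, neg_add, T_add]
    have h : (T (-n) * T n : ℤ[T;T⁻¹]) = 1 := by rw [← T_add]; simp
    linear_combination LaurentPolynomial.C (ε : ℤ) * T (-k) * f * h
  rw [this, map_zsmul, zsmul_eq_mul]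
  rcases Int.units_eq_one_or ε with rfl | rfl
  · simp
  · simp [Left.sign_neg]

theorem unitNormalize_toLaurent {p : ℤ[X]} (h : 0 < p.coeff 0) :
    unitNormalize (toLaurent p) = p := by
  have hc : ∀ n : ℕ, (toLaurent p).coeff n = p.coeff n := fun n => by
    rw [coeff_toLaurent]
    exact Finsupp.mapDomain_apply Nat.castEmbedding.injective _ _
  have hk : IsLeast {n : ℤ | (toLaurent p).coeff n ≠ 0} 0 := by
    refine ⟨?_, fun n hn => ?_⟩
    · have := hc 0
      rw [Nat.cast_zero] at this
      rw [Set.mem_ofPred_eq, this]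
      exact h.ne'
    · have := Finsupp.mem_support_iff.2 hn
      rw [support_coeff_toLaurent, Finset.mem_map] at this
      obtain ⟨m, -, rfl⟩ := this
      exact Int.natCast_nonneg m
  have h0 := hc 0
  rw [Nat.cast_zero] at h0
  rw [unitNormalize_eq hk, h0, sign_pos h]
  simp

/-- The exponent `n` must be the degree of `f`: otherwise `f.reverse` or `g` would be divisible by
`X`, against their nonzero constant terms. -/
theorem reverse_eq_of_invert {f g : ℤ[X]} {n : ℕ} (hf : f.coeff 0 ≠ 0) (hg : g.coeff 0 ≠ 0)
    (h : T n * invert (toLaurent f) = toLaurent g) : f.reverse = g := by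
  have hr : f.reverse.coeff 0 ≠ 0 := by
    rw [coeff_zero_reverse, Ne, leadingCoeff_eq_zero]
    rintro rfl
    exact hf (coeff_zero 0)
  have key : X ^ n * f.reverse = X ^ f.natDegree * g := by
    apply toLaurent_injective
    rw [map_mul, map_mul, toLaurent_reverse, ← h, toLaurent_X_pow, toLaurent_X_pow]
    ring
  rcases lt_trichotomy n f.natDegree with hn | hn | hn
  · obtain ⟨k, hk⟩ := Nat.exists_eq_add_of_lt hn
    rw [hk, add_assoc, pow_add, mul_assoc] at key
    have := mul_left_cancel₀ (pow_ne_zero n X_ne_zero) key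
    rw [this, pow_succ', mul_assoc, coeff_X_mul_zero] at hr
    exact (hr rfl).elim
  · rw [hn] at key
    exact mul_left_cancel₀ (pow_ne_zero _ X_ne_zero) key
  · obtain ⟨k, hk⟩ := Nat.exists_eq_add_of_lt hn
    rw [hk, add_assoc, pow_add, mul_assoc] at key
    have := mul_left_cancel₀ (pow_ne_zero _ X_ne_zero) key
    rw [← this, pow_succ', mul_assoc, coeff_X_mul_zero] at hg
    exact (hg rfl).elim

/-! ### The polynomials J and I as matrix entries -/

theorem normalizedJones_eq {α : ℚ}
    (h : (jonesEntry X (altProd (qR X) (qL X) (evenCF α)) : ℤ[X]).coeff 0 = 1) :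
    normalizedJones α = jonesEntry X (altProd (qR X) (qL X) (evenCF α)) := by
  obtain ⟨ε, n, hb⟩ := exists_bracket_twists (evenCF α)
  set J : ℤ[X] := jonesEntry X (altProd (qR X) (qL X) (evenCF α)) with hJ
  -- Evaluation at -A⁴ is q ↦ -q followed by q ↦ A⁴, exactly what `contract 4` and `comp (-X)` undo
  -- in `normalizedJones`.
  have hq : (toLaurent.comp (expand ℤ 4 : ℤ[X] →ₐ[ℤ] ℤ[X]).toRingHom) (-X) =
      (-T 4 : ℤ[T;T⁻¹]) := by
    simp
  have hcomp : jonesEntry (-T 4) (altProd (qR (-T 4)) (qL (-T 4)) (evenCF α)) =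
      toLaurent (expand ℤ 4 (J.comp (-X))) := by
    have h1 := jonesEntry_map (compRingHom (-X) : ℤ[X] →+* ℤ[X]) X (evenCF α)
    have h2 := jonesEntry_map (toLaurent.comp (expand ℤ 4 : ℤ[X] →ₐ[ℤ] ℤ[X]).toRingHom) (-X)
      (evenCF α)
    simp only [coe_compRingHom_apply, X_comp] at h1
    rw [hq, ← h1] at h2
    exact h2.symm
  have h0 : 0 < (expand ℤ 4 (J.comp (-X))).coeff 0 := by
    have : (expand ℤ 4 (J.comp (-X))).coeff 0 = J.coeff 0 := by
      simp [coeff_zero_eq_eval_zero, expand_eval]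
    rw [this, h]
    exact one_pos
  change bracket (rationalLink α) = _ at hb
  rw [normalizedJones, jones, unitNormalize_unit_mul, hb, unitNormalize_unit_mul,
    hcomp, unitNormalize_toLaurent h0, contract_expand 4 (by norm_num), comp_assoc]
  simp

/-- At q = 0 both deformed matrices fix the column (0, 1), hence so does every product. -/
theorem core_coeff_zero (l : List ℕ) {x y : Matrix (Fin 2) (Fin 2) ℤ[X]}
    (h : x = qR X ∧ y = qL X ∨ x = qL X ∧ y = qR X) :
    (altProd x y l 0 1).coeff 0 = 0 ∧ (altProd x y l 1 1).coeff 0 = 1 := by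
  have step : ∀ z N : Matrix (Fin 2) (Fin 2) ℤ[X], z = qR X ∨ z = qL X →
      (N 0 1).coeff 0 = 0 ∧ (N 1 1).coeff 0 = 1 →
      ((z * N) 0 1).coeff 0 = 0 ∧ ((z * N) 1 1).coeff 0 = 1 := by
    rintro z N (rfl | rfl) ⟨h1, h2⟩ <;>
      simp [qR, qL, Matrix.mul_apply, Fin.sum_univ_two, h1, h2]
  have steps : ∀ (a : ℕ) (z N : Matrix (Fin 2) (Fin 2) ℤ[X]), z = qR X ∨ z = qL X →
      (N 0 1).coeff 0 = 0 ∧ (N 1 1).coeff 0 = 1 →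
      ((z ^ a * N) 0 1).coeff 0 = 0 ∧ ((z ^ a * N) 1 1).coeff 0 = 1 := by
    intro a z N hz hN
    induction a with
    | zero => simpa using hN
    | succ a ih =>
      rw [pow_succ', mul_assoc]
      exact step z _ hz ih
  induction l generalizing x y with
  | nil => simp [altProd]
  | cons a l ih => exact steps a x _ (by tauto) (ih (by tauto))

theorem traceJones_eq {α : ℚ} {a b : ℕ} {l : List ℕ} (hl : Even l.length)
    (h : evenCF α = (a + 1) :: (l ++ [b + 1])) {N : Matrix (Fin 2) (Fin 2) ℤ[X]}
    (hN : N = altProd (qR X) (qL X) (a :: (l ++ [b]))) :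
    traceJones α = unitNormalize (toLaurent (N 0 1 - X * N 1 0)) := by
  have hM : altProd (qR X) (qL X) (evenCF α) = qR X * N * qL X := by
    rw [h, altProd_add_ends _ _ _ _ _ _ hl, hN, pow_one, pow_one]
  obtain ⟨hb, hd⟩ : (N 0 1).coeff 0 = 0 ∧ (N 1 1).coeff 0 = 1 := by
    rw [hN]; exact core_coeff_zero _ (Or.inl ⟨rfl, rfl⟩)
  set J : ℤ[X] := X ^ 2 * (N 0 0 + N 1 0) + N 0 1 + N 1 1 with hJ
  set K : ℤ[X] := X * N 1 0 + X ^ 2 * N 0 0 + X * N 0 1 + N 1 1 with hK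
  have hJ' : jonesEntry X (altProd (qR X) (qL X) (evenCF α)) = J := by
    rw [hM, qR_mul_mul_qL, jonesEntry]
    simp
    ring
  have hJ0 : J.coeff 0 = 1 := by
    rw [hJ]
    simp [mul_coeff_zero, hb, hd]
  have hK0 : K.coeff 0 = 1 := by
    rw [hK]
    simp [mul_coeff_zero, hd]
  have hjones : normalizedJones α = J := by
    rw [← hJ']; exact normalizedJones_eq (by rw [hJ', hJ0])
  have hrev : J.reverse = K := by
    -- The exponent is the number of crossings, the power of q produced by the flip relation.
    refine reverse_eq_of_invert (n := (evenCF α).sum) (by simp [hJ0]) (by simp [hK0]) ?_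
    have hqp : (T 1 * T (-1) : ℤ[T;T⁻¹]) = 1 := by rw [← T_add]; simp
    have e1 := pow_mul_jonesEntry hqp (evenCF α)
    have e2 := jonesEntry_map ((invert (R := ℤ)).toRingEquiv.toRingHom.comp toLaurent) X (evenCF α)
    have e3 : ((invert (R := ℤ)).toRingEquiv.toRingHom.comp toLaurent) X = T (-1) := by
      simp
    rw [e3, hJ'] at e2
    change invert (toLaurent J) = _ at e2
    have e4 := map_altProd ((toLaurent (R := ℤ)).mapMatrix : Matrix (Fin 2) (Fin 2) ℤ[X] →+*
      Matrix (Fin 2) (Fin 2) ℤ[T;T⁻¹]).toMonoidHom (qR X) (qL X) (evenCF α)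
    change (toLaurent (R := ℤ)).mapMatrix _ =
      altProd ((toLaurent (R := ℤ)).mapMatrix _) ((toLaurent (R := ℤ)).mapMatrix _) _ at e4
    rw [map_qR, map_qL, toLaurent_X, hM] at e4
    rw [← e2, ← e4] at e1
    refine (isUnit_T 1).mul_left_cancel ?_
    rw [T_pow, mul_one] at e1
    have h2 : (T 2 : ℤ[T;T⁻¹]) = T 1 * T 1 := by rw [← T_add]; rfl
    rw [e1, hK, qR_mul_mul_qL]
    simp [h2, -mul_T_assoc]
    ring
  -- The `N 0 0` and `N 1 1` terms of `K` and `J` agree and cancel.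
  have hdiv : J.reverse - J = (X - Polynomial.C 1) * (N 0 1 - X * N 1 0) := by
    rw [hrev, hJ, hK, map_one]
    ring
  rw [traceJones, hjones, hdiv, ← map_one Polynomial.C, mul_divByMonic_cancel_left _ (monic_X_sub_C _)]

/-! ### Continued fractions -/

/-- Numerator and denominator of the continued fraction `[a₁, …, aₙ]`. -/
def cfPair : List ℕ → ℕ × ℕ
  | [] => (1, 0)
  | a :: l => (a * (cfPair l).1 + (cfPair l).2, (cfPair l).1)

theorem cfPair_coprime (l : List ℕ) : (cfPair l).1.Coprime (cfPair l).2 := by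
  induction l with
  | nil => simp [cfPair]
  | cons a l ih =>
    simpa [cfPair, Nat.coprime_mul_left_add_left] using ih.symm

theorem cfPair_append_one (l : List ℕ) (x : ℕ) : cfPair (l ++ [x, 1]) = cfPair (l ++ [x + 1]) := by
  induction l with
  | nil => simp [cfPair]
  | cons a l ih => simp only [List.cons_append, cfPair, ih]

theorem euclid_cons {a p q : ℕ} (hq : q < p) : euclid (a * p + q) p = a :: euclid p q := by
  obtain ⟨p, rfl⟩ := Nat.exists_eq_succ_of_ne_zero (Nat.ne_zero_of_lt hq)
  rw [Nat.succ_eq_add_one] at *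
  rw [euclid, mul_comm, Nat.mul_add_mod, Nat.mod_eq_of_lt hq,
    Nat.mul_add_div p.succ_pos, Nat.div_eq_of_lt hq, add_zero]

/-- A last quotient of at least 2 makes each tail after the first quotient exceed 1, so that the
Euclidean algorithm recovers the quotients one at a time. -/
theorem euclid_cfPair (l : List ℕ) (hl : ∀ a ∈ l, 1 ≤ a) (x : ℕ) (hx : 2 ≤ x) :
    euclid (cfPair (l ++ [x])).1 (cfPair (l ++ [x])).2 = l ++ [x] ∧
      0 < (cfPair (l ++ [x])).2 ∧ (cfPair (l ++ [x])).2 < (cfPair (l ++ [x])).1 := by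
  induction l with
  | nil =>
    simp only [List.nil_append, cfPair]
    refine ⟨?_, by omega, by omega⟩
    rw [euclid_cons one_pos, euclid]
  | cons a l ih =>
    obtain ⟨h1, h2, h3⟩ := ih fun b hb => hl b (List.mem_cons_of_mem _ hb)
    have ha := hl a List.mem_cons_self
    simp only [List.cons_append, cfPair]
    refine ⟨?_, by omega, by nlinarith⟩
    rw [euclid_cons h3, h1]

theorem evenCF_cfPair {l : List ℕ} (hl : ∀ a ∈ l, 1 ≤ a) (he : Even l.length) (hne : l ≠ []) :
    evenCF (((cfPair l).1 : ℚ) / (cfPair l).2) = l ∧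
      0 < (cfPair l).2 ∧ (cfPair l).2 < (cfPair l).1 := by
  obtain ⟨l, x, rfl⟩ : ∃ l' x, l = l' ++ [x] := ⟨_, _, (List.dropLast_append_getLast hne).symm⟩
  have hx : 1 ≤ x := hl x (by simp)
  -- Here `m ++ [y]` is the Euclidean form of the same fraction: the given word itself if it ends in
  -- at least 2, and otherwise the odd word with the final 1 absorbed into its predecessor.
  have key : ∀ (m : List ℕ) (y : ℕ), (∀ a ∈ m, 1 ≤ a) → 2 ≤ y →
      cfPair (l ++ [x]) = cfPair (m ++ [y]) →
      (if Even (m ++ [y]).length then m ++ [y] else m ++ [y - 1, 1]) = l ++ [x] →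
      evenCF (((cfPair (l ++ [x])).1 : ℚ) / (cfPair (l ++ [x])).2) = l ++ [x] ∧
      0 < (cfPair (l ++ [x])).2 ∧ (cfPair (l ++ [x])).2 < (cfPair (l ++ [x])).1 := by
    intro m y hm hy h1 h2
    have hco := cfPair_coprime (m ++ [y])
    obtain ⟨h3, h4, h5⟩ := euclid_cfPair m hm y hy
    rw [h1]
    refine ⟨?_, h4, h5⟩
    generalize cfPair (m ++ [y]) = p at *
    have hpos : (0 : ℤ) < p.2 := by exact_mod_cast h4
    have hn : ((p.1 : ℚ) / p.2).num = p.1 := by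
      simpa using Rat.num_div_eq_of_coprime (a := p.1) (b := p.2) hpos (by simpa using hco)
    have hd : ((p.1 : ℚ) / p.2).den = p.2 := by
      have := Rat.den_div_eq_of_coprime (a := p.1) (b := p.2) hpos (by simpa using hco)
      simpa using this
    rw [← h2, evenCF, hn, hd, Int.toNat_natCast, h3]
    simp
  rcases hx.eq_or_lt with rfl | hx
  · have hl0 : l ≠ [] := by rintro rfl; simp at he
    obtain ⟨m, y, rfl⟩ : ∃ l' x, l = l' ++ [x] := ⟨_, _, (List.dropLast_append_getLast hl0).symm⟩
    have hy : 1 ≤ y := hl y (by simp)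
    refine key m (y + 1) (fun a ha => hl a (by simp [ha])) (by omega) ?_ ?_
    · rw [List.append_assoc]
      exact cfPair_append_one m y
    · have : ¬ Even (m ++ [y + 1]).length := by
        simpa [Nat.even_add_one] using he
      rw [if_neg this]
      simp
  · exact key l x (fun a ha => hl a (by simp [ha])) hx rfl (if_pos he)

/-- Both parities are carried through the induction, since a Euclidean step flips the parity. At `s
= 1` the choice between [r] and [r - 1, 1] provides either one. -/
theorem exists_cfPair_eq (s : ℕ) : ∀ (r : ℕ) (b : Bool), 0 < s → s < r → r.Coprime s →
    ∃ l : List ℕ, l ≠ [] ∧ (∀ a ∈ l, 1 ≤ a) ∧ (Even l.length ↔ b = true) ∧ cfPair l = (r, s) := by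
  induction s using Nat.strong_induction_on with
  | _ s ih =>
    intro r b hs hr hco
    rcases (Nat.succ_le_of_lt hs).eq_or_lt with h | h
    · obtain rfl : s = 1 := h.symm
      cases b
      · exact ⟨[r], by simp, by simpa using hr.le, by simp, by simp [cfPair]⟩
      · refine ⟨[r - 1, 1], by simp, by simp; omega, by simp, ?_⟩
        simp [cfPair, Nat.sub_add_cancel hr.le]
    · have hco' : s.Coprime (r % s) := by
        rwa [Nat.Coprime, Nat.gcd_comm, ← Nat.gcd_rec, Nat.gcd_comm]
      have hpos : 0 < r % s := by
        rcases Nat.eq_zero_or_pos (r % s) with h0 | h0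
        · rw [h0, Nat.coprime_zero_right] at hco'
          omega
        · exact h0
      obtain ⟨l, hne, hl, he, hp⟩ := ih (r % s) (Nat.mod_lt _ hs) s (!b) hpos (Nat.mod_lt _ hs) hco'
      refine ⟨(r / s) :: l, by simp, ?_, ?_, ?_⟩
      · intro a ha
        rcases List.mem_cons.1 ha with rfl | ha
        · exact Nat.div_pos hr.le hs
        · exact hl a ha
      · rw [List.length_cons, Nat.even_add_one, he]
        cases b <;> simp
      · rw [cfPair, hp]
        simp only [Prod.mk.injEq, and_true]
        exact Nat.div_add_mod' r s

/-! ### Classical matrices and words with both ends lengthened -/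

theorem pow_R (a : ℕ) : (!![1, 1; 0, 1] : Matrix (Fin 2) (Fin 2) ℤ) ^ a = !![1, (a : ℤ); 0, 1] := by
  induction a with
  | zero => simp [Matrix.one_fin_two]
  | succ a ih => rw [pow_succ, ih]; simp [add_comm]

theorem pow_L (a : ℕ) : (!![1, 0; 1, 1] : Matrix (Fin 2) (Fin 2) ℤ) ^ a = !![1, 0; (a : ℤ), 1] := by
  induction a with
  | zero => simp [Matrix.one_fin_two]
  | succ a ih => rw [pow_succ, ih]; simp

theorem exists_cfMatrix_eq : ∀ l : List ℕ, Even l.length → ∃ t u : ℕ,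
    cfMatrix l = !![((cfPair l).1 : ℤ), (t : ℤ); ((cfPair l).2 : ℤ), (u : ℤ)]
  | [], _ => ⟨0, 1, by simp [cfMatrix, cfPair, Matrix.one_fin_two]⟩
  | [_], h => by simp at h
  | a :: b :: l, h => by
    obtain ⟨t, u, ih⟩ := exists_cfMatrix_eq l (by simpa [Nat.even_add_one] using h)
    refine ⟨t + a * (b * t + u), b * t + u, ?_⟩
    rw [cfMatrix, ih, pow_R, pow_L]
    simp only [cfPair]
    ext i j
    fin_cases i <;> fin_cases j <;> simp <;> ring

theorem exists_ends {l : List ℕ} (hl : ∀ a ∈ l, 1 ≤ a) (he : Even l.length) (hne : l ≠ []) :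
    ∃ (a b : ℕ) (m : List ℕ), Even m.length ∧ l = (a + 1) :: (m ++ [b + 1]) := by
  obtain ⟨a, l, rfl⟩ := List.exists_cons_of_ne_nil hne
  have hne' : l ≠ [] := by rintro rfl; simp at he
  obtain ⟨m, b, rfl⟩ : ∃ l' x, l = l' ++ [x] := ⟨_, _, (List.dropLast_append_getLast hne').symm⟩
  have ha : 1 ≤ a := hl a (by simp)
  have hb : 1 ≤ b := hl b (by simp)
  refine ⟨a - 1, b - 1, m, by simpa [Nat.even_add_one] using he, ?_⟩
  rw [Nat.sub_add_cancel ha, Nat.sub_add_cancel hb]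

theorem traceJones_eq_of_evenCF {α β : ℚ} {a b i : ℕ} {m : List ℕ} (hm : Even m.length)
    (hα : evenCF α = (a + 1) :: (m ++ [b + 1]))
    (hβ : evenCF β = (a + i + 1) :: (m ++ [b + i + 1])) :
    traceJones β = traceJones α := by
  rw [traceJones_eq hm hα rfl, traceJones_eq hm hβ (altProd_add_ends _ _ _ _ _ _ hm).symm,
    trace_invariant, map_mul, toLaurent_X_pow]
  have := unitNormalize_unit_mul 1 i (toLaurent (altProd (qR X) (qL X) (a :: (m ++ [b])) 0 1 -
    X * altProd (qR X) (qL X) (a :: (m ++ [b])) 1 0))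
  simpa using this

end QRat

/-! ### The family α_i -/

theorem mainTheorem7 (r s : ℤ) (hs : 0 < s) (hrs : s < r) (hcop : IsCoprime r s) :
    ∃ t u : ℤ, QRat.cfMatrix (QRat.evenCF ((r : ℚ) / s)) = !![r, t; s, u] ∧
      (∀ i : ℕ, 0 < s + i * u ∧ IsCoprime (r + i * (s + t) + i ^ 2 * u) (s + i * u)) ∧
      ∃ α : ℕ → ℚ,
        (∀ i : ℕ, α i = ((r + i * (s + t) + i ^ 2 * u : ℤ) : ℚ) / ((s + i * u : ℤ) : ℚ)) ∧
        Function.Injective α ∧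
        ∀ i : ℕ, 1 < α i ∧ QRat.traceJones (α i) = QRat.traceJones ((r : ℚ) / s) := by
  open QRat in
  lift r to ℕ using by omega
  lift s to ℕ using by omega
  obtain ⟨l, hne, hl, he, hp⟩ := exists_cfPair_eq s r true (by omega) (by omega)
    (Nat.isCoprime_iff_coprime.1 hcop)
  replace he : Even l.length := he.2 rfl
  obtain ⟨a, b, m, hm, rfl⟩ := exists_ends hl he hne
  have hcf := (evenCF_cfPair hl he hne).1
  obtain ⟨t, u, hM⟩ := exists_cfMatrix_eq _ he
  rw [hp] at hcf hM
  set w : ℕ → List ℕ := fun i => (a + i + 1) :: (m ++ [b + i + 1]) with hw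
  -- This is RⁱMLⁱ with RⁱM multiplied out; its first column yields the numerator and denominator of
  -- α_i in `hwp`.
  have hwM : ∀ i : ℕ, cfMatrix (w i) = !![(r : ℤ) + i * s, t + i * u; s, u] *
      !![1, 0; (i : ℤ), 1] := by
    intro i
    have := altProd_add_ends (!![1, 1; 0, 1] : Matrix (Fin 2) (Fin 2) ℤ) !![1, 0; 1, 1]
      (a + 1) (b + 1) i m hm
    rw [← cfMatrix_eq_altProd, ← cfMatrix_eq_altProd, hM, pow_R, pow_L] at this
    simp only [hw, add_right_comm _ i 1]
    rw [this]
    congr 1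
    ext i j
    fin_cases i <;> fin_cases j <;> simp
  have hwpos : ∀ i, ∀ x ∈ w i, 1 ≤ x := by
    intro i x hx
    simp only [hw, List.mem_cons, List.mem_append, List.not_mem_nil, or_false] at hx
    rcases hx with rfl | hx | rfl
    · omega
    · exact hl x (by simp [hx])
    · omega
  have hwe : ∀ i, Even (w i).length := fun i => by simpa [hw] using he
  have hwp : ∀ i : ℕ, ((cfPair (w i)).1 : ℤ) = r + i * (s + t) + i ^ 2 * u ∧
      ((cfPair (w i)).2 : ℤ) = s + i * u := by
    intro i
    obtain ⟨t', u', h⟩ := exists_cfMatrix_eq (w i) (hwe i)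
    rw [hwM] at h
    have h0 := congrFun (congrFun h 0) 0
    have h1 := congrFun (congrFun h 1) 0
    simp at h0 h1
    exact ⟨by linear_combination -h0, by linear_combination -h1⟩
  have hwcf : ∀ i : ℕ, evenCF (((cfPair (w i)).1 : ℚ) / (cfPair (w i)).2) = w i ∧
      0 < (cfPair (w i)).2 ∧ (cfPair (w i)).2 < (cfPair (w i)).1 := fun i =>
    evenCF_cfPair (hwpos i) (hwe i) (by simp [hw])
  refine ⟨t, u, ?_, fun i => ?_, fun i => ((cfPair (w i)).1 : ℚ) / (cfPair (w i)).2,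
    fun i => ?_, fun i j hij => ?_, fun i => ⟨?_, ?_⟩⟩
  · rw [← hM, ← hcf]
    simp
  · rw [← (hwp i).1, ← (hwp i).2]
    exact ⟨by exact_mod_cast (hwcf i).2.1, Nat.isCoprime_iff_coprime.2 (cfPair_coprime _)⟩
  · rw [← (hwp i).1, ← (hwp i).2]
    simp
  -- Distinctness is read off the expansions, whose first quotients are `a + i + 1`.
  · have := congrArg evenCF hij
    simp only at this
    rw [(hwcf i).1, (hwcf j).1] at this
    have := (List.cons.inj this).1
    omega
  · obtain ⟨-, h1, h2⟩ := hwcf i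
    rw [one_lt_div (by exact_mod_cast h1)]
    exact_mod_cast h2
  · refine traceJones_eq_of_evenCF hm ?_ (hwcf i).1
    simpa using hcf
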